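/- Let $(Q,\mathfrak m,\mathsf k)$ be a commutative Noetherian local ring with $\mathfrak m^3=0$ and $\operatorname{char}\mathsf k=0$. Assume that if $\mathfrak m$ is a principal ideal, then $\mathfrak m^2=0$. Let $(f,g)$ be an exact pair of zero divisors in $Q$, that is, $f,g\in Q$ are nonzero, $\operatorname{ann}_Q(f)=(g)$ and $\operatorname{ann}_Q(g)=(f)$, and set $R=Q/(f)$. Let $M,N$ be finitely generated $R$-modules such that $\mathfrak m(M\otimes_R N)=0$ and $gN=0$. For a finitely generated $Q$-module $L$ let $$H_L(t)=\sum_{n\ge 0}\dim_{\mathsf k}\bigl(\mathfrak m^nL/\mathfrak m^{n+1}L\bigr)\,t^n$$ be its Hilbert series. Then $\operatorname{Tor}_i^Q(M,N)$ has finite length for every $i\ge 0$, and the generalized Poincaré series $$P^Q_{M,N}(t)=\sum_{i\ge 0}\ell_Q\bigl(\operatorname{Tor}_i^Q(M,N)\bigr)\,t^i$$ satisfies $$P^Q_{M,N}(t)=\frac{H_M(-t)\,H_N(-t)}{H_Q(-t)}.$$ -/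

import Mathlib

open CategoryTheory IsLocalRing TensorProduct PowerSeries

universe u

noncomputable section

/-- `(f, g)` is an exact pair of zero divisors in `Q`: both elements are nonzero,
`ann f = (g)` and `ann g = (f)`. -/
structure IsExactPair {Q : Type u} [CommRing Q] (f g : Q) : Prop where
  left_ne_zero : f ≠ 0
  right_ne_zero : g ≠ 0
  ann_left : (Ideal.span {f}).annihilator = Ideal.span {g}
  ann_right : (Ideal.span {g}).annihilator = Ideal.span {f}

/-- The dimension of `P / 𝔪 P` over the residue field `Q / 𝔪`. -/
def residueDim (Q : Type u) [CommRing Q] [IsLocalRing Q]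
    (P : Type u) [AddCommGroup P] [Module Q P] : ℕ :=
  Module.finrank (Q ⧸ maximalIdeal Q) (P ⧸ (maximalIdeal Q • ⊤ : Submodule Q P))

/-- The dimension of `𝔪 ^ n M / 𝔪 ^ (n + 1) M = P / 𝔪 P`, where `P = 𝔪 ^ n M`, over the residue
field `Q / 𝔪`. -/
def hilbertCoeff (Q : Type u) [CommRing Q] [IsLocalRing Q]
    (M : Type u) [AddCommGroup M] [Module Q M] (n : ℕ) : ℕ :=
  residueDim Q (maximalIdeal Q ^ n • ⊤ : Submodule Q M)

/-- The Hilbert series `H_M(t) = ∑ dim_k (𝔪 ^ n M / 𝔪 ^ (n + 1) M) t ^ n`. -/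
def hilbertSeries (Q : Type u) [CommRing Q] [IsLocalRing Q]
    (M : Type u) [AddCommGroup M] [Module Q M] : ℚ⟦X⟧ :=
  PowerSeries.mk fun n => (hilbertCoeff Q M n : ℚ)

/-- The `Q`-module `Tor_i^Q(M, N)`. -/
abbrev torModule (Q : Type u) [CommRing Q] (M N : Type u) [AddCommGroup M] [Module Q M]
    [AddCommGroup N] [Module Q N] (i : ℕ) : ModuleCat.{u} Q :=
  ((Tor (ModuleCat.{u} Q) i).obj (ModuleCat.of Q M)).obj (ModuleCat.of Q N)

/-- The generalized Poincaré series `P^Q_{M,N}(t) = ∑ ℓ_Q(Tor_i^Q(M, N)) t ^ i`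
(meaningful when all these lengths are finite). -/
def poincareSeries (Q : Type u) [CommRing Q] (M N : Type u) [AddCommGroup M] [Module Q M]
    [AddCommGroup N] [Module Q N] : ℚ⟦X⟧ :=
  PowerSeries.mk fun i => ((Module.length Q (torModule Q M N i)).toNat : ℚ)

end

/-! Write k = Q/𝔪, R = Q/(f), e = dim 𝔪², with Tor taken over Q. Since 𝔪³ = 0, the ideal 𝔪² lies in
both (f) and (g), so it kills every module killed by f or by g. Counting lengths in 0 → Q/(g) → Q →
R → 0 then gives H_Q(-t) = (1 - t)(1 - et).

As f and g kill N, dimension shifting along this sequence, with f and g exchanging roles at each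
step, gives Tor_i(R, N) ≅ N for all i (`nonempty_torObj_equiv`). The crux is
`range_torMap_le_smul_top`: a map k → R sending 1 to the class of some x ∈ 𝔪 carries Tor_i(k, N)
into 𝔪 Tor_i(R, N). Hence Tor_i(𝔪R, N) has image 𝔪 Tor_i(R, N) ≅ 𝔪N, and the long exact sequence of
0 → 𝔪R → R → k → 0 becomes a recursion for ℓ Tor_i(k, N), equivalent to P_{k,N}(t) H_Q(-t) =
H_N(-t).

A map k → M with 1 ↦ az, a ∈ 𝔪, factors through R. Since M ⊗ Tor_i(R, N) ≅ M ⊗ N is killed by 𝔪, the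
crux forces Tor_i(𝔪M, N) → Tor_i(M, N) to vanish (`torSubtype_eq_zero`). The long exact sequence of
0 → 𝔪M → M → M/𝔪M → 0 breaks into short ones, so P_{M,N}(t) = H_M(-t) P_{k,N}(t). -/

noncomputable section

/-! ### Tor as the homology of X ⊗ C, functorial and linear in X -/

section TensorComplex

open MonoidalCategory

variable {Q : Type u} [CommRing Q] (C : ChainComplex (ModuleCat.{u} Q) ℕ)

/-- The complex `X ⊗ C`, functorially in the module `X`. -/
def tensorComplex : ModuleCat.{u} Q ⥤ ChainComplex (ModuleCat.{u} Q) ℕ where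
  obj X := (((tensoringLeft (ModuleCat.{u} Q)).obj X).mapHomologicalComplex _).obj C
  map φ := (NatTrans.mapHomologicalComplex ((tensoringLeft (ModuleCat.{u} Q)).map φ) _).app C
  map_id X := by
    rw [CategoryTheory.Functor.map_id, NatTrans.mapHomologicalComplex_id]; rfl
  map_comp φ ψ := by
    rw [Functor.map_comp, NatTrans.mapHomologicalComplex_comp]; rfl

instance : (tensorComplex C).Additive where
  map_add {X Y φ ψ} := by
    ext n : 1
    exact MonoidalPreadditive.add_whiskerRight φ ψ

instance : (tensorComplex C).Linear Q where
  map_smul {X Y} φ a := by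
    ext n : 1
    exact MonoidalLinear.smul_whiskerRight a φ _

theorem tensorComplex_shortExact (hC : ∀ n, Module.Flat Q (C.X n))
    {S : ShortComplex (ModuleCat.{u} Q)} (hS : S.ShortExact) :
    (S.map (tensorComplex C)).ShortExact := by
  refine HomologicalComplex.shortExact_of_degreewise_shortExact _ fun n => ?_
  have := hC n
  have hex : Function.Exact S.f.hom S.g.hom :=
    (ShortComplex.ShortExact.moduleCat_exact_iff_function_exact S).1 hS.exact
  refine ShortComplex.ShortExact.mk' ?_ ?_ ?_
  · refine (ShortComplex.ShortExact.moduleCat_exact_iff_function_exact _).2 ?_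
    exact rTensor_exact (C.X n) hex hS.moduleCat_surjective_g
  · refine (ModuleCat.mono_iff_injective _).2 ?_
    exact Module.Flat.rTensor_preserves_injective_linearMap _ hS.moduleCat_injective_f
  · refine (ModuleCat.epi_iff_surjective _).2 ?_
    exact LinearMap.rTensor_surjective (C.X n) hS.moduleCat_surjective_g

variable (i : ℕ)

/-- The homology module `H_i(X ⊗ C)`. -/
def torObj (X : Type u) [AddCommGroup X] [Module Q X] : ModuleCat.{u} Q :=
  ((tensorComplex C).obj (ModuleCat.of Q X)).homology i

variable {X Y Z : Type u} [AddCommGroup X] [Module Q X] [AddCommGroup Y] [Module Q Y]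
  [AddCommGroup Z] [Module Q Z]
  {X' Y' Z' : Type u} [AddCommGroup X'] [Module Q X'] [AddCommGroup Y'] [Module Q Y']
  [AddCommGroup Z'] [Module Q Z']

/-- The map `H_i(X ⊗ C) → H_i(Y ⊗ C)` induced by a linear map `X → Y`. -/
def torMap : (X →ₗ[Q] Y) →ₗ[Q] (torObj C i X →ₗ[Q] torObj C i Y) where
  toFun φ := (HomologicalComplex.homologyMap ((tensorComplex C).map (ModuleCat.ofHom φ)) i).hom
  map_add' φ ψ := by
    rw [ModuleCat.ofHom_add, Functor.map_add, HomologicalComplex.homologyMap_add]; rfl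
  map_smul' a φ := by
    rw [show ModuleCat.ofHom (a • φ) = a • ModuleCat.ofHom φ from rfl, Functor.map_smul]
    exact congrArg ModuleCat.Hom.hom (ShortComplex.homologyMap_smul
      ((HomologicalComplex.shortComplexFunctor (ModuleCat.{u} Q) _ i).map
        ((tensorComplex C).map (ModuleCat.ofHom φ))) a)

theorem torMap_apply (φ : X →ₗ[Q] Y) :
    torMap C i φ =
      (HomologicalComplex.homologyMap ((tensorComplex C).map (ModuleCat.ofHom φ)) i).hom := rfl

@[simp]
theorem torMap_id : torMap C i (LinearMap.id : X →ₗ[Q] X) = LinearMap.id := by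
  rw [torMap_apply, ModuleCat.ofHom_id, CategoryTheory.Functor.map_id,
    HomologicalComplex.homologyMap_id]
  rfl

theorem torMap_comp (ψ : Y →ₗ[Q] Z) (φ : X →ₗ[Q] Y) :
    torMap C i (ψ ∘ₗ φ) = torMap C i ψ ∘ₗ torMap C i φ := by
  simp only [torMap_apply, ModuleCat.ofHom_comp, CategoryTheory.Functor.map_comp,
    HomologicalComplex.homologyMap_comp]
  rfl

theorem torMap_comp_apply (ψ : Y →ₗ[Q] Z) (φ : X →ₗ[Q] Y) (x : torObj C i X) :
    torMap C i (ψ ∘ₗ φ) x = torMap C i ψ (torMap C i φ x) := by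
  rw [torMap_comp]; rfl

/-- An isomorphism of modules induces an isomorphism on `H_i(- ⊗ C)`. -/
def torEquiv (e : X ≃ₗ[Q] Y) : torObj C i X ≃ₗ[Q] torObj C i Y :=
  LinearEquiv.ofLinearMap (torMap C i e) (torMap C i e.symm)
    (by rw [← torMap_comp]; simp) (by rw [← torMap_comp]; simp)

section LongExactSequence

variable (hC : ∀ n, Module.Flat Q (C.X n)) {f : X →ₗ[Q] Y} {g : Y →ₗ[Q] Z}
  (hf : Function.Injective f) (hfg : Function.Exact f g) (hg : Function.Surjective g)

/-- The short complex of modules given by an exact pair of linear maps. -/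
abbrev shortComplexOfExact (hfg : Function.Exact f g) : ShortComplex (ModuleCat.{u} Q) :=
  ShortComplex.mk (ModuleCat.ofHom f) (ModuleCat.ofHom g)
    (by ext x; exact hfg.apply_apply_eq_zero x)

include hf hg in
theorem shortComplexOfExact_shortExact : (shortComplexOfExact hfg).ShortExact :=
  ShortComplex.ShortExact.mk'
    ((ShortComplex.ShortExact.moduleCat_exact_iff_function_exact _).2 hfg)
    ((ModuleCat.mono_iff_injective _).2 hf) ((ModuleCat.epi_iff_surjective _).2 hg)

/-- The connecting map `H_{i+1}(Z ⊗ C) → H_i(X ⊗ C)` of a short exact sequence. -/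
def torδ : torObj C (i + 1) Z →ₗ[Q] torObj C i X :=
  ((tensorComplex_shortExact C hC (shortComplexOfExact_shortExact hf hfg hg)).δ (i + 1) i rfl).hom

theorem exact_torδ_torMap :
    Function.Exact (torδ C i hC hf hfg hg) (torMap C i f) :=
  (ShortComplex.ShortExact.moduleCat_exact_iff_function_exact _).1
    ((tensorComplex_shortExact C hC
      (shortComplexOfExact_shortExact hf hfg hg)).homology_exact₁ (i + 1) i rfl)

theorem exact_torMap_torδ :
    Function.Exact (torMap C (i + 1) g) (torδ C i hC hf hfg hg) :=
  (ShortComplex.ShortExact.moduleCat_exact_iff_function_exact _).1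
    ((tensorComplex_shortExact C hC
      (shortComplexOfExact_shortExact hf hfg hg)).homology_exact₃ (i + 1) i rfl)

include hC hf hfg hg in
theorem exact_torMap_torMap : Function.Exact (torMap C i f) (torMap C i g) :=
  (ShortComplex.ShortExact.moduleCat_exact_iff_function_exact _).1
    ((tensorComplex_shortExact C hC (shortComplexOfExact_shortExact hf hfg hg)).homology_exact₂ i)

theorem torδ_naturality {f' : X' →ₗ[Q] Y'} {g' : Y' →ₗ[Q] Z'}
    (hf' : Function.Injective f') (hfg' : Function.Exact f' g') (hg' : Function.Surjective g')
    (a : X →ₗ[Q] X') (b : Y →ₗ[Q] Y') (c : Z →ₗ[Q] Z')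
    (hab : f' ∘ₗ a = b ∘ₗ f) (hbc : g' ∘ₗ b = c ∘ₗ g) (z : torObj C (i + 1) Z) :
    torδ C i hC hf' hfg' hg' (torMap C (i + 1) c z) =
      torMap C i a (torδ C i hC hf hfg hg z) := by
  let φ : shortComplexOfExact hfg ⟶ shortComplexOfExact hfg' :=
    { τ₁ := ModuleCat.ofHom a
      τ₂ := ModuleCat.ofHom b
      τ₃ := ModuleCat.ofHom c
      comm₁₂ := by
        simp only [← ModuleCat.ofHom_comp, hab]
      comm₂₃ := by
        simp only [← ModuleCat.ofHom_comp, hbc] }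
  have h := HomologicalComplex.HomologySequence.δ_naturality
    ((tensorComplex C).mapShortComplex.map φ)
    (tensorComplex_shortExact C hC (shortComplexOfExact_shortExact hf hfg hg))
    (tensorComplex_shortExact C hC (shortComplexOfExact_shortExact hf' hfg' hg')) (i + 1) i rfl
  exact (congrArg (fun k => k.hom z) h).symm

include hg in
-- In degree 0 no differential leaves the complex, so homology agrees with opcycles, and these
-- preserve epimorphisms.
theorem torMap_zero_surjective : Function.Surjective (torMap C 0 g) := by
  have h : ∀ n, Epi (((tensorComplex C).map (ModuleCat.ofHom g)).f n) := fun n =>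
    (ModuleCat.epi_iff_surjective _).2 (LinearMap.rTensor_surjective (C.X n) hg)
  have : Epi (HomologicalComplex.homologyMap ((tensorComplex C).map (ModuleCat.ofHom g)) 0) := by
    have h1 := HomologicalComplex.homologyι_naturality
      ((tensorComplex C).map (ModuleCat.ofHom g)) 0
    have : Epi (HomologicalComplex.opcyclesMap ((tensorComplex C).map (ModuleCat.ofHom g)) 0) := by
      infer_instance
    have e : HomologicalComplex.homologyMap ((tensorComplex C).map (ModuleCat.ofHom g)) 0 =
        HomologicalComplex.homologyι _ 0 ≫
          HomologicalComplex.opcyclesMap ((tensorComplex C).map (ModuleCat.ofHom g)) 0 ≫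
          inv (HomologicalComplex.homologyι _ 0) := by
      rw [← reassoc_of% h1]; simp
    rw [e]; infer_instance
  exact (ModuleCat.epi_iff_surjective _).1 this

end LongExactSequence

/-- `Q ⊗ C` is isomorphic to `C`. -/
def tensorComplexUnitIso : (tensorComplex C).obj (ModuleCat.of Q Q) ≅ C :=
  (NatIso.mapHomologicalComplex (leftUnitorNatIso (ModuleCat.{u} Q)) _).app C ≪≫
    (Functor.mapHomologicalComplexIdIso _ _).app C

variable {N : Type u} [AddCommGroup N] [Module Q N]
  (P : ProjectiveResolution (ModuleCat.of Q N))

theorem ProjectiveResolution.flat (n : ℕ) : Module.Flat Q (P.complex.X n) := by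
  have : Module.Projective Q (P.complex.X n) :=
    (IsProjective.iff_projective (R := Q) (P.complex.X n)).2 (P.projective n)
  infer_instance

theorem subsingleton_torObj_self_succ : Subsingleton (torObj P.complex (i + 1) Q) := by
  rw [← ModuleCat.isZero_iff_subsingleton]
  exact ((P.complex_exactAt_succ i).isZero_homology).of_iso
    ((HomologicalComplex.homologyFunctor _ _ _).mapIso (tensorComplexUnitIso P.complex))

/-- `H_0(Q ⊗ P)` is `N` for a projective resolution `P` of `N`. -/
def torObjZeroSelfEquiv : torObj P.complex 0 Q ≃ₗ[Q] N :=
  (((HomologicalComplex.homologyFunctor _ _ 0).mapIso (tensorComplexUnitIso P.complex)) ≪≫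
    isoOfQuasiIsoAt P.π 0 ≪≫
    HomologicalComplex.singleObjHomologySelfIso _ _ _).toLinearEquiv

/-- `Tor_i(M, N)` is computed by `M ⊗ P` for a projective resolution `P` of `N`. -/
def torModuleEquiv : torModule Q X N i ≃ₗ[Q] torObj P.complex i X :=
  (P.isoLeftDerivedObj ((tensoringLeft (ModuleCat.{u} Q)).obj (ModuleCat.of Q X)) i).toLinearEquiv

end TensorComplex

/-! ### Hilbert coefficients as lengths -/

section Hilbert

variable (Q : Type u) [CommRing Q] [IsLocalRing Q] (P : Type u) [AddCommGroup P] [Module Q P]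

/-- `P / 𝔪 P` is a direct sum of `residueDim Q P` copies of the residue field. -/
theorem nonempty_quotient_smul_top_equiv [Module.Finite Q P] :
    Nonempty ((P ⧸ (maximalIdeal Q • ⊤ : Submodule Q P)) ≃ₗ[Q]
      (Fin (residueDim Q P) → Q ⧸ maximalIdeal Q)) := by
  let _ : Field (Q ⧸ maximalIdeal Q) := Ideal.Quotient.field _
  have : Module.Finite (Q ⧸ maximalIdeal Q) (P ⧸ (maximalIdeal Q • ⊤ : Submodule Q P)) :=
    Module.Finite.of_restrictScalars_finite Q _ _
  exact ⟨(Module.finBasis (Q ⧸ maximalIdeal Q)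
    (P ⧸ (maximalIdeal Q • ⊤ : Submodule Q P))).equivFun.restrictScalars Q⟩

theorem length_quotient_maximalIdeal : Module.length Q (Q ⧸ maximalIdeal Q) = 1 := by
  have : IsSimpleModule Q (Q ⧸ maximalIdeal Q) :=
    isSimpleModule_iff_isCoatom.2 (maximalIdeal.isMaximal Q).out
  exact Module.length_eq_one _ _

theorem length_quotient_smul_top [Module.Finite Q P] :
    Module.length Q (P ⧸ (maximalIdeal Q • ⊤ : Submodule Q P)) = residueDim Q P := by
  obtain ⟨e⟩ := nonempty_quotient_smul_top_equiv Q P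
  rw [e.length_eq]
  simp [length_quotient_maximalIdeal]

variable {P} in
theorem residueDim_congr {P' : Type u} [AddCommGroup P'] [Module Q P'] [Module.Finite Q P]
    (e : P ≃ₗ[Q] P') : residueDim Q P = residueDim Q P' := by
  have : Module.Finite Q P' := Module.Finite.equiv e
  have h : (maximalIdeal Q • ⊤ : Submodule Q P).map (e : P →ₗ[Q] P') = maximalIdeal Q • ⊤ := by
    rw [Submodule.map_smul'', Submodule.map_top, LinearEquiv.range]
  have := (Submodule.Quotient.equiv _ _ e h).length_eq
  rw [length_quotient_smul_top, length_quotient_smul_top] at this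
  exact_mod_cast this

theorem hilbertCoeff_zero [Module.Finite Q P] : hilbertCoeff Q P 0 = residueDim Q P := by
  have e : (maximalIdeal Q ^ 0 • ⊤ : Submodule Q P) = ⊤ := by simp
  exact (residueDim_congr Q
    ((LinearEquiv.ofEq _ _ e).trans Submodule.topEquiv).symm).symm

/-- A finite module killed by `𝔪` is a direct sum of copies of the residue field. -/
theorem nonempty_equiv_of_smul_top_eq_bot [Module.Finite Q P]
    (h : (maximalIdeal Q • ⊤ : Submodule Q P) = ⊥) :
    Nonempty (P ≃ₗ[Q] (Fin (residueDim Q P) → Q ⧸ maximalIdeal Q)) := by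
  obtain ⟨e⟩ := nonempty_quotient_smul_top_equiv Q P
  exact ⟨(Submodule.quotEquivOfEqBot _ h).symm.trans e⟩

theorem maximalIdeal_smul_smul_top_eq_bot
    (h : (maximalIdeal Q ^ 2 • ⊤ : Submodule Q P) = ⊥) :
    (maximalIdeal Q • ⊤ : Submodule Q (maximalIdeal Q • ⊤ : Submodule Q P)) = ⊥ := by
  apply Submodule.map_injective_of_injective (Submodule.subtype_injective _)
  rw [Submodule.map_smul'', Submodule.map_subtype_top, Submodule.map_bot, ← h, pow_two,
    Submodule.mul_smul]

variable [IsNoetherianRing Q] [Module.Finite Q P]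

theorem hilbertCoeff_one :
    hilbertCoeff Q P 1 = residueDim Q (maximalIdeal Q • ⊤ : Submodule Q P) :=
  residueDim_congr Q (LinearEquiv.ofEq _ _ (by rw [pow_one]))

theorem length_pow_smul_top (n : ℕ) :
    Module.length Q (maximalIdeal Q ^ n • ⊤ : Submodule Q P) =
      Module.length Q (maximalIdeal Q ^ (n + 1) • ⊤ : Submodule Q P) + hilbertCoeff Q P n := by
  set W : Submodule Q P := maximalIdeal Q ^ n • ⊤ with hW
  have h : (maximalIdeal Q • ⊤ : Submodule Q W).map W.subtype = maximalIdeal Q ^ (n + 1) • ⊤ := by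
    rw [Submodule.map_smul'', Submodule.map_subtype_top, hW, pow_succ', Submodule.mul_smul]
  rw [Module.length_eq_add_of_exact (maximalIdeal Q • ⊤ : Submodule Q W).subtype
    (maximalIdeal Q • ⊤ : Submodule Q W).mkQ (Submodule.subtype_injective _)
    (Submodule.mkQ_surjective _) (LinearMap.exact_subtype_mkQ _),
    length_quotient_smul_top, ← h,
    (Submodule.equivMapOfInjective W.subtype W.subtype_injective _).length_eq]
  rfl

theorem length_eq_add_hilbertCoeff_zero :
    Module.length Q P =
      Module.length Q (maximalIdeal Q • ⊤ : Submodule Q P) + hilbertCoeff Q P 0 := by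
  have := length_pow_smul_top Q P 0
  rwa [pow_zero, Ideal.one_eq_top, Submodule.top_smul, Module.length_top, zero_add, pow_one] at this

theorem hilbertCoeff_eq_zero {n : ℕ} (h : (maximalIdeal Q ^ n • ⊤ : Submodule Q P) = ⊥) :
    hilbertCoeff Q P n = 0 := by
  have := length_pow_smul_top Q P n
  rw [h, Module.length_bot] at this
  exact_mod_cast (add_eq_zero.1 this.symm).2

theorem length_smul_top (h : (maximalIdeal Q ^ 2 • ⊤ : Submodule Q P) = ⊥) :
    Module.length Q (maximalIdeal Q • ⊤ : Submodule Q P) = hilbertCoeff Q P 1 := by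
  have := length_pow_smul_top Q P 1
  rwa [h, Module.length_bot, zero_add, pow_one] at this

end Hilbert

theorem Ideal.smul_top_quotient {Q : Type u} [CommRing Q] (I J : Ideal Q) :
    (I • ⊤ : Submodule Q (Q ⧸ J)) = Submodule.map J.mkQ I := by
  have := Submodule.map_smul'' I (⊤ : Submodule Q Q) J.mkQ
  rw [Submodule.map_top, Submodule.range_mkQ] at this
  rw [← this, smul_eq_mul, Ideal.mul_top]

/-! ### Exact pairs of zero divisors when 𝔪³ = 0 -/

section ExactPair

variable {Q : Type u} [CommRing Q] {f g : Q}

namespace IsExactPair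

theorem symm (h : IsExactPair f g) : IsExactPair g f :=
  ⟨h.right_ne_zero, h.left_ne_zero, h.ann_right, h.ann_left⟩

theorem mul_eq_zero_iff (h : IsExactPair f g) (x : Q) : f * x = 0 ↔ x ∈ Ideal.span {g} := by
  rw [← h.ann_left, Submodule.mem_annihilator_span_singleton, smul_eq_mul, mul_comm]

/-- Multiplication by `f` as a map `Q / (g) → Q`. -/
def mulLeft (h : IsExactPair f g) : (Q ⧸ Ideal.span {g}) →ₗ[Q] Q :=
  Submodule.liftQ _ (LinearMap.mulLeft Q f) fun x hx => (h.mul_eq_zero_iff x).2 hx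

@[simp]
theorem mulLeft_mkQ (h : IsExactPair f g) (x : Q) :
    h.mulLeft ((Ideal.span {g}).mkQ x) = f * x := rfl

theorem mulLeft_injective (h : IsExactPair f g) : Function.Injective h.mulLeft := by
  rw [← LinearMap.ker_eq_bot, mulLeft]
  apply Submodule.ker_liftQ_eq_bot
  intro x hx
  exact (h.mul_eq_zero_iff x).1 hx

theorem range_mulLeft (h : IsExactPair f g) : LinearMap.range h.mulLeft = Ideal.span {f} := by
  ext y
  rw [Ideal.mem_span_singleton']
  constructor
  · rintro ⟨x, rfl⟩
    obtain ⟨x, rfl⟩ := Submodule.mkQ_surjective _ x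
    exact ⟨x, mul_comm _ _⟩
  · rintro ⟨x, rfl⟩
    exact ⟨(Ideal.span {g}).mkQ x, mul_comm _ _⟩

theorem exact_mulLeft_mkQ (h : IsExactPair f g) :
    Function.Exact h.mulLeft (Ideal.span {f}).mkQ := by
  rw [LinearMap.exact_iff, Submodule.ker_mkQ, h.range_mulLeft]

section Short

variable [IsLocalRing Q] (hshort : maximalIdeal Q ^ 3 = ⊥)
  (hprincipal : (maximalIdeal Q).IsPrincipal → maximalIdeal Q ^ 2 = ⊥) (h : IsExactPair f g)

include h in
theorem right_mem : g ∈ maximalIdeal Q := by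
  rw [mem_maximalIdeal, mem_nonunits_iff]
  intro hg
  apply h.left_ne_zero
  have : g * f = 0 := (h.symm.mul_eq_zero_iff f).2 (Ideal.mem_span_singleton_self f)
  simpa using (hg.mul_right_eq_zero).1 this

include h in
theorem left_mem : f ∈ maximalIdeal Q := h.symm.right_mem

include hshort in
theorem mul_mul_eq_zero {a b c : Q} (ha : a ∈ maximalIdeal Q) (hb : b ∈ maximalIdeal Q)
    (hc : c ∈ maximalIdeal Q) : a * (b * c) = 0 := by
  have : a * (b * c) ∈ maximalIdeal Q ^ 3 := by
    rw [pow_succ', pow_two]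
    exact Ideal.mul_mem_mul ha (Ideal.mul_mem_mul hb hc)
  rwa [hshort, Ideal.mem_bot] at this

include hshort in
theorem mul_eq_zero_of_mem_sq {a b : Q} (ha : a ∈ maximalIdeal Q) (hb : b ∈ maximalIdeal Q ^ 2) :
    a * b = 0 := by
  have : a * b ∈ maximalIdeal Q ^ 3 := by
    rw [pow_succ']
    exact Ideal.mul_mem_mul ha hb
  rwa [hshort, Ideal.mem_bot] at this

include hshort hprincipal h in
-- If f ∈ 𝔪², then 𝔪f = 0, so 𝔪 = ann f = (g) is principal; then 𝔪² = 0 and f = 0.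
theorem left_notMem_sq : f ∉ maximalIdeal Q ^ 2 := by
  intro hf
  have hm : maximalIdeal Q = Ideal.span {g} := by
    apply le_antisymm
    · intro x hx
      rw [← h.mul_eq_zero_iff, mul_comm]
      exact mul_eq_zero_of_mem_sq hshort hx hf
    · rw [Ideal.span_singleton_le_iff_mem]
      exact h.right_mem
  have := hprincipal ⟨⟨g, hm⟩⟩
  rw [this] at hf
  exact h.left_ne_zero hf

include hshort h in
-- 𝔪²g ⊆ 𝔪³ = 0, so 𝔪² ⊆ ann g = (f).
theorem sq_le_span_left : maximalIdeal Q ^ 2 ≤ Ideal.span {f} := by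
  intro x hx
  rw [← h.symm.mul_eq_zero_iff]
  exact mul_eq_zero_of_mem_sq hshort h.right_mem hx

include hshort hprincipal h in
theorem exists_mem_mul_eq_of_mem_sq {x : Q} (hx : x ∈ maximalIdeal Q ^ 2) :
    ∃ b ∈ maximalIdeal Q, f * b = x := by
  obtain ⟨b, rfl⟩ := Ideal.mem_span_singleton'.1 (h.sq_le_span_left hshort hx)
  refine ⟨b, ?_, mul_comm _ _⟩
  rw [mem_maximalIdeal, mem_nonunits_iff]
  intro hb
  -- A unit cofactor would put f itself in 𝔪².
  exact h.left_notMem_sq hshort hprincipal ((Ideal.unit_mul_mem_iff_mem _ hb).1 hx)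

include hshort hprincipal h in
theorem smul_span_eq_sq : maximalIdeal Q • Ideal.span {f} = maximalIdeal Q ^ 2 := by
  apply le_antisymm
  · rw [pow_two, smul_eq_mul]
    exact Ideal.mul_mono_right ((Ideal.span_singleton_le_iff_mem _).2 h.left_mem)
  · intro x hx
    obtain ⟨b, hb, rfl⟩ := h.exists_mem_mul_eq_of_mem_sq hshort hprincipal hx
    rw [mul_comm, smul_eq_mul]
    exact Ideal.mul_mem_mul hb (Ideal.mem_span_singleton_self f)

include hshort h in
theorem sq_smul_top_eq_bot {M : Type u} [AddCommGroup M] [Module Q M]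
    (hM : ∀ z : M, f • z = 0) : (maximalIdeal Q ^ 2 • ⊤ : Submodule Q M) = ⊥ := by
  rw [eq_bot_iff, Submodule.smul_le]
  intro r hr z _
  obtain ⟨b, rfl⟩ := Ideal.mem_span_singleton'.1 (h.sq_le_span_left hshort hr)
  rw [Submodule.mem_bot, mul_smul, hM, smul_zero]

omit [IsLocalRing Q] in
theorem smul_quotient_span_eq_zero (x : Q ⧸ Ideal.span {f}) : f • x = 0 := by
  obtain ⟨y, rfl⟩ := Submodule.mkQ_surjective _ x
  rw [← map_smul, Submodule.mkQ_apply, Submodule.Quotient.mk_eq_zero, smul_eq_mul]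
  exact Ideal.mul_mem_right _ _ (Ideal.mem_span_singleton_self f)

include h in
theorem hilbertCoeff_quotient_zero [IsNoetherianRing Q] :
    hilbertCoeff Q (Q ⧸ Ideal.span {f}) 0 = 1 := by
  have hle : Ideal.span {f} ≤ maximalIdeal Q :=
    (Ideal.span_singleton_le_iff_mem _).2 h.left_mem
  have := length_quotient_smul_top Q (Q ⧸ Ideal.span {f})
  rw [← hilbertCoeff_zero, Ideal.smul_top_quotient,
    (Submodule.quotientQuotientEquivQuotient _ (maximalIdeal Q) hle).length_eq,
    length_quotient_maximalIdeal] at this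
  exact_mod_cast this.symm

theorem hilbertCoeff_self_zero [IsNoetherianRing Q] : hilbertCoeff Q Q 0 = 1 := by
  have := length_quotient_smul_top Q Q
  rw [← hilbertCoeff_zero, smul_eq_mul, Ideal.mul_top, length_quotient_maximalIdeal] at this
  exact_mod_cast this.symm

include hshort hprincipal h in
-- Multiplication by f embeds Q/(g) in Q and carries 𝔪(Q/(g)) onto 𝔪f = 𝔪².
theorem hilbertCoeff_self_two [IsNoetherianRing Q] :
    hilbertCoeff Q Q 2 = hilbertCoeff Q (Q ⧸ Ideal.span {g}) 1 := by
  have h1 := length_pow_smul_top Q Q 2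
  have e3 : (maximalIdeal Q ^ 3 • ⊤ : Submodule Q Q) = ⊥ := by rw [hshort, Submodule.bot_smul]
  rw [show 2 + 1 = 3 from rfl, e3, Module.length_bot, zero_add, smul_eq_mul, Ideal.mul_top] at h1
  have h2 := length_smul_top Q (Q ⧸ Ideal.span {g})
    (h.symm.sq_smul_top_eq_bot hshort smul_quotient_span_eq_zero)
  have e : (maximalIdeal Q • ⊤ : Submodule Q (Q ⧸ Ideal.span {g})).map h.mulLeft =
      maximalIdeal Q ^ 2 := by
    rw [Submodule.map_smul'', Submodule.map_top, h.range_mulLeft,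
      h.smul_span_eq_sq hshort hprincipal]
  have h3 := (Submodule.equivMapOfInjective h.mulLeft h.mulLeft_injective
    (maximalIdeal Q • ⊤ : Submodule Q (Q ⧸ Ideal.span {g}))).length_eq
  rw [e] at h3
  rw [h3, h1] at h2
  exact_mod_cast h2

include hshort hprincipal h in
-- Both Q/(f) and Q/(g) have length 1 + dim 𝔪², and these lengths add up to ℓ(Q) = 1 + dim 𝔪/𝔪² +
-- dim 𝔪².
theorem hilbertCoeff_self_one [IsNoetherianRing Q] :
    hilbertCoeff Q Q 1 = hilbertCoeff Q Q 2 + 1 := by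
  have l1 := length_eq_add_hilbertCoeff_zero Q (Q ⧸ Ideal.span {f})
  have l2 := length_eq_add_hilbertCoeff_zero Q (Q ⧸ Ideal.span {g})
  rw [length_smul_top Q _ (h.sq_smul_top_eq_bot hshort smul_quotient_span_eq_zero),
    h.hilbertCoeff_quotient_zero, ← h.symm.hilbertCoeff_self_two hshort hprincipal] at l1
  rw [length_smul_top Q _ (h.symm.sq_smul_top_eq_bot hshort smul_quotient_span_eq_zero),
    h.symm.hilbertCoeff_quotient_zero, ← h.hilbertCoeff_self_two hshort hprincipal] at l2
  have l3 := Module.length_eq_add_of_exact _ _ h.mulLeft_injective (Submodule.mkQ_surjective _)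
    h.exact_mulLeft_mkQ
  have l4 := length_eq_add_hilbertCoeff_zero Q Q
  have l5 := length_pow_smul_top Q Q 1
  have l6 := length_pow_smul_top Q Q 2
  have e3 : (maximalIdeal Q ^ 3 • ⊤ : Submodule Q Q) = ⊥ := by rw [hshort, Submodule.bot_smul]
  rw [show 2 + 1 = 3 from rfl, e3, Module.length_bot, zero_add] at l6
  rw [show 1 + 1 = 2 from rfl, l6, pow_one] at l5
  rw [l5, l3, l1, l2, hilbertCoeff_self_zero] at l4
  norm_cast at l4
  omega

end Short

end IsExactPair

end ExactPair

/-! ### Finite direct sums in the first variable -/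

section PiDecomposition

variable {Q : Type u} [CommRing Q] (C : ChainComplex (ModuleCat.{u} Q) ℕ) (i : ℕ)
  {X Y V K : Type u} [AddCommGroup X] [Module Q X] [AddCommGroup Y] [Module Q Y]
  [AddCommGroup V] [Module Q V] [AddCommGroup K] [Module Q K] {n : ℕ}

theorem LinearMap.sum_single_comp_proj_eq_id :
    ∑ j, LinearMap.single Q (fun _ : Fin n => K) j ∘ₗ LinearMap.proj j = LinearMap.id :=
  LinearMap.ext fun x => by simp [LinearMap.sum_apply, Finset.univ_sum_single]

/-- `H_i(- ⊗ C)` commutes with finite powers. -/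
def torPiEquiv : torObj C i (Fin n → K) ≃ₗ[Q] (Fin n → torObj C i K) :=
  LinearEquiv.ofLinearMap
    (LinearMap.pi fun j => torMap C i (LinearMap.proj j))
    (∑ j, torMap C i (LinearMap.single Q (fun _ => K) j) ∘ₗ LinearMap.proj j)
    (by
      refine LinearMap.pi_ext' fun l => LinearMap.ext fun x => funext fun j => ?_
      simp only [LinearMap.coe_comp, Function.comp_apply, LinearMap.pi_apply, LinearMap.sum_apply,
        LinearMap.proj_apply, LinearMap.single_apply, map_sum, LinearMap.id_apply,
        ← torMap_comp_apply]
      rw [Finset.sum_eq_single l]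
      · rw [Pi.single_eq_same]
        rcases eq_or_ne j l with rfl | hjl
        · rw [LinearMap.proj_comp_single_same, torMap_id, Pi.single_eq_same]; rfl
        · rw [LinearMap.proj_comp_single_ne _ _ _ _ hjl, map_zero, Pi.single_eq_of_ne hjl]; rfl
      · intro b _ hb
        rw [Pi.single_eq_of_ne hb, map_zero]
      · simp)
    (by
      refine LinearMap.ext fun x => ?_
      simp only [LinearMap.coe_comp, Function.comp_apply, LinearMap.pi_apply, LinearMap.sum_apply,
        LinearMap.proj_apply, ← torMap_comp_apply]
      rw [← LinearMap.sum_apply, ← map_sum, LinearMap.sum_single_comp_proj_eq_id, torMap_id])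

theorem length_torObj_of_equiv_pi (e : V ≃ₗ[Q] (Fin n → K)) :
    Module.length Q (torObj C i V) = n * Module.length Q (torObj C i K) := by
  rw [((torEquiv C i e).trans (torPiEquiv C i)).length_eq]
  simp

/-- Used with K the residue field: the image of a map out of a vector space V is controlled by its
restrictions to lines, that is, by single elements of V. -/
theorem range_torMap_le_of_equiv_pi (e : V ≃ₗ[Q] (Fin n → K)) (ψ : V →ₗ[Q] Y)
    (W : Submodule Q (torObj C i Y))
    (h : ∀ φ : K →ₗ[Q] V, LinearMap.range (torMap C i (ψ ∘ₗ φ)) ≤ W) :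
    LinearMap.range (torMap C i ψ) ≤ W := by
  rintro _ ⟨v, rfl⟩
  have hψ : ψ = ∑ j, (ψ ∘ₗ ((e.symm : (Fin n → K) →ₗ[Q] V) ∘ₗ
      LinearMap.single Q (fun _ => K) j)) ∘ₗ (LinearMap.proj j ∘ₗ (e : V →ₗ[Q] (Fin n → K))) := by
    refine LinearMap.ext fun x => ?_
    have := LinearMap.congr_fun (LinearMap.sum_single_comp_proj_eq_id (Q := Q) (K := K)) (e x)
    simp only [LinearMap.sum_apply, LinearMap.comp_apply, LinearMap.id_apply,
      LinearEquiv.coe_coe] at this ⊢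
    rw [← map_sum, ← map_sum, this, e.symm_apply_apply]
  rw [hψ, map_sum, LinearMap.sum_apply]
  refine Submodule.sum_mem _ fun j _ => ?_
  rw [torMap_comp_apply]
  exact h _ ⟨_, rfl⟩

end PiDecomposition

/-! ### Tor of Q/(f) with N, and the image of Tor of the residue field -/

section TorResidue

variable {Q : Type u} [CommRing Q] {N : Type u} [AddCommGroup N] [Module Q N]
  (P : ProjectiveResolution (ModuleCat.of Q N)) {f g : Q} (h : IsExactPair f g)
  (hf : ∀ x : N, f • x = 0)

namespace IsExactPair

include hf in
-- Composed with the surjection induced by Q → Q/(g), the map becomes multiplication by f on N,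
-- which is zero.
theorem torMap_mulLeft_zero : torMap P.complex 0 h.mulLeft = 0 := by
  refine LinearMap.ext fun x => ?_
  obtain ⟨x, rfl⟩ := torMap_zero_surjective P.complex (Submodule.mkQ_surjective (Ideal.span {g})) x
  have e : h.mulLeft ∘ₗ (Ideal.span {g}).mkQ = f • LinearMap.id := LinearMap.ext fun y => rfl
  rw [← torMap_comp_apply, e, map_smul, torMap_id]
  apply (torObjZeroSelfEquiv P).injective
  simp [hf]

/-- The connecting map for `0 → Q / (g) → Q → Q / (f) → 0`. -/
abbrev torδ (i : ℕ) :
    torObj P.complex (i + 1) (Q ⧸ Ideal.span {f}) →ₗ[Q] torObj P.complex i (Q ⧸ Ideal.span {g}) :=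
  _root_.torδ P.complex i (ProjectiveResolution.flat P) h.mulLeft_injective h.exact_mulLeft_mkQ
    (Submodule.mkQ_surjective _)

include hf in
-- The neighbouring terms Tor(Q, N) vanish in positive degrees; in degree 0 it is the map into
-- Tor_0(Q, N) that vanishes.
theorem torδ_bijective (i : ℕ) : Function.Bijective (h.torδ P i) := by
  have h1 := exact_torδ_torMap P.complex i (ProjectiveResolution.flat P) h.mulLeft_injective
    h.exact_mulLeft_mkQ (Submodule.mkQ_surjective _)
  have h2 := exact_torMap_torδ P.complex i (ProjectiveResolution.flat P) h.mulLeft_injective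
    h.exact_mulLeft_mkQ (Submodule.mkQ_surjective _)
  have := subsingleton_torObj_self_succ i P
  constructor
  · rw [injective_iff_map_eq_zero]
    intro x hx
    obtain ⟨y, rfl⟩ := (h2 x).1 hx
    rw [Subsingleton.elim y 0, map_zero]
  · intro x
    refine (h1 x).1 ?_
    cases i with
    | zero => rw [h.torMap_mulLeft_zero P hf]; rfl
    | succ i =>
      have := subsingleton_torObj_self_succ i P
      exact Subsingleton.elim _ _

include h hf in
theorem torMap_mkQ_zero_bijective :
    Function.Bijective (torMap P.complex 0 (Ideal.span {f}).mkQ) := by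
  have h1 := exact_torMap_torMap P.complex 0 (ProjectiveResolution.flat P) h.mulLeft_injective
    h.exact_mulLeft_mkQ (Submodule.mkQ_surjective _)
  refine ⟨?_, torMap_zero_surjective P.complex (Submodule.mkQ_surjective _)⟩
  rw [injective_iff_map_eq_zero]
  intro x hx
  obtain ⟨y, rfl⟩ := (h1 x).1 hx
  rw [h.torMap_mulLeft_zero P hf]; rfl

/-- `Tor_i(Q / (f), N)` is isomorphic to `N` when `f` and `g` kill `N`. -/
theorem nonempty_torObj_equiv (i : ℕ) : ∀ {f g : Q}, IsExactPair f g →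
    (∀ x : N, f • x = 0) → (∀ x : N, g • x = 0) →
    Nonempty (torObj P.complex i (Q ⧸ Ideal.span {f}) ≃ₗ[Q] N) := by
  -- The kernel of Q → Q/(f) is Q/(g), so each step swaps f and g; both must vary in the induction.
  induction i with
  | zero =>
    intro f g h hf _
    exact ⟨(LinearEquiv.ofBijective _ (h.torMap_mkQ_zero_bijective P hf)).symm.trans
      (torObjZeroSelfEquiv P)⟩
  | succ i ih =>
    intro f g h hf hg
    obtain ⟨e⟩ := ih h.symm hg hf
    exact ⟨(LinearEquiv.ofBijective _ (h.torδ_bijective P hf i)).trans e⟩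

variable [IsLocalRing Q] [IsNoetherianRing Q] (hshort : maximalIdeal Q ^ 3 = ⊥)
  (hprincipal : (maximalIdeal Q).IsPrincipal → maximalIdeal Q ^ 2 = ⊥)

omit [IsNoetherianRing Q] in
include hshort hprincipal in
/-- For `x ∈ 𝔪`, division by `f` of the multiplication by `x` on `𝔪`, as a map
`𝔪 / 𝔪 ^ 2 → Q / (g)`. -/
theorem exists_mulLeft_comp_eq {f g : Q} (h : IsExactPair f g) {x : Q} (hx : x ∈ maximalIdeal Q) :
    ∃ ψ : (maximalIdeal Q ⧸ (maximalIdeal Q • ⊤ : Submodule Q (maximalIdeal Q))) →ₗ[Q]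
        (Q ⧸ Ideal.span {g}),
      h.mulLeft ∘ₗ (ψ ∘ₗ Submodule.mkQ _) =
        LinearMap.mulLeft Q x ∘ₗ (maximalIdeal Q).subtype ∧
      ∀ v, ∃ b ∈ maximalIdeal Q, ψ v = (Ideal.span {g}).mkQ b := by
  have hxm : ∀ a ∈ maximalIdeal Q, x * a ∈ maximalIdeal Q ^ 2 := fun a ha => by
    rw [pow_two]; exact Ideal.mul_mem_mul hx ha
  let ψ₀ : maximalIdeal Q →ₗ[Q] (Q ⧸ Ideal.span {g}) :=
    (LinearEquiv.ofInjective _ h.mulLeft_injective).symm.toLinearMap ∘ₗ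
      LinearMap.codRestrict (LinearMap.range h.mulLeft)
        (LinearMap.mulLeft Q x ∘ₗ (maximalIdeal Q).subtype) fun a => by
          rw [h.range_mulLeft]
          exact h.sq_le_span_left hshort (hxm a a.2)
  have hψ₀ : ∀ a : maximalIdeal Q, h.mulLeft (ψ₀ a) = x * a := fun a => by
    have := LinearEquiv.ofInjective_apply (h := h.mulLeft_injective) h.mulLeft (ψ₀ a)
    rw [← this]
    simp [ψ₀]
  -- Since 𝔪³ = 0, multiplication by x kills 𝔪², so the quotient by f descends to 𝔪/𝔪².
  have hker : (maximalIdeal Q • ⊤ : Submodule Q (maximalIdeal Q)) ≤ LinearMap.ker ψ₀ := by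
    rw [Submodule.smul_le]
    intro r hr a _
    rw [LinearMap.mem_ker]
    apply h.mulLeft_injective
    rw [hψ₀, map_zero]
    exact mul_mul_eq_zero hshort hx hr a.2
  refine ⟨Submodule.liftQ _ ψ₀ hker, LinearMap.ext hψ₀, fun v => ?_⟩
  obtain ⟨a, rfl⟩ := Submodule.mkQ_surjective _ v
  obtain ⟨b, hb, hbx⟩ := h.exists_mem_mul_eq_of_mem_sq hshort hprincipal (hxm a a.2)
  refine ⟨b, hb, h.mulLeft_injective ?_⟩
  rw [h.mulLeft_mkQ, hbx]
  exact hψ₀ a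

include hshort hprincipal in
-- Multiplication by x on Q maps 0 → 𝔪 → Q → k → 0 to 0 → Q/(g) → Q → Q/(f) → 0, with φ on the right
-- and a ↦ xa/f on the left. The left map factors through the vector space 𝔪/𝔪² and takes values in
-- 𝔪(Q/(g)), so the induction hypothesis for (g, f) applies to it; naturality of the connecting
-- maps, bijective on the bottom row, transfers the bound to φ.
theorem range_torMap_le_smul_top (i : ℕ) : ∀ {f g : Q}, IsExactPair f g →
    (∀ x : N, f • x = 0) → (∀ x : N, g • x = 0) → ∀ x ∈ maximalIdeal Q,
    ∀ φ : (Q ⧸ maximalIdeal Q) →ₗ[Q] (Q ⧸ Ideal.span {f}),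
      φ ∘ₗ (maximalIdeal Q).mkQ = (Ideal.span {f}).mkQ ∘ₗ LinearMap.mulLeft Q x →
      LinearMap.range (torMap P.complex i φ) ≤ maximalIdeal Q • ⊤ := by
  induction i with
  | zero =>
    rintro f g h hf hg x hx φ hφ _ ⟨v, rfl⟩
    obtain ⟨v, rfl⟩ :=
      torMap_zero_surjective P.complex (Submodule.mkQ_surjective (maximalIdeal Q)) v
    have e : (Ideal.span {f}).mkQ ∘ₗ LinearMap.mulLeft Q x = x • (Ideal.span {f}).mkQ :=
      LinearMap.ext fun y => rfl
    rw [← torMap_comp_apply, hφ, e, map_smul]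
    exact Submodule.smul_mem_smul hx Submodule.mem_top
  | succ i ih =>
    rintro f g h hf hg x hx φ hφ _ ⟨v, rfl⟩
    obtain ⟨ψ, hψ, hψm⟩ := exists_mulLeft_comp_eq hshort hprincipal h hx
    obtain ⟨e⟩ := nonempty_quotient_smul_top_equiv Q (maximalIdeal Q)
    have hψr : LinearMap.range (torMap P.complex i ψ) ≤ maximalIdeal Q • ⊤ := by
      refine range_torMap_le_of_equiv_pi P.complex i e ψ _ fun χ => ?_
      obtain ⟨b, hb, hb'⟩ := hψm (χ ((maximalIdeal Q).mkQ 1))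
      refine ih h.symm hg hf b hb (ψ ∘ₗ χ) (LinearMap.ext_ring ?_)
      simpa using hb'
    have hnat := torδ_naturality P.complex i (ProjectiveResolution.flat P)
      (Submodule.subtype_injective (maximalIdeal Q)) (LinearMap.exact_subtype_mkQ _)
      (Submodule.mkQ_surjective _) h.mulLeft_injective h.exact_mulLeft_mkQ
      (Submodule.mkQ_surjective _) (ψ ∘ₗ Submodule.mkQ _) (LinearMap.mulLeft Q x) φ hψ hφ.symm v
    have hmem : h.torδ P i (torMap P.complex (i + 1) φ v) ∈
        (maximalIdeal Q • ⊤ : Submodule Q (torObj P.complex i (Q ⧸ Ideal.span {g}))) := by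
      rw [IsExactPair.torδ, hnat, torMap_comp_apply]
      exact hψr ⟨_, rfl⟩
    let E := LinearEquiv.ofBijective _ (h.torδ_bijective P hf i)
    have hE : (maximalIdeal Q • ⊤ : Submodule Q (torObj P.complex i (Q ⧸ Ideal.span {g}))).map
        E.symm.toLinearMap = maximalIdeal Q • ⊤ := by
      rw [Submodule.map_smul'', Submodule.map_top, LinearEquiv.range]
    rw [← hE]
    exact ⟨_, hmem, E.symm_apply_apply _⟩

end IsExactPair

end TorResidue

/-! ### Length counts along 0 → 𝔪M → M → M/𝔪M → 0 -/

theorem LinearMap.length_eq_ker_add_range {Q : Type*} [CommRing Q] {X Y : Type*} [AddCommGroup X]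
    [Module Q X] [AddCommGroup Y] [Module Q Y] (φ : X →ₗ[Q] Y) :
    Module.length Q X = Module.length Q (LinearMap.ker φ) + Module.length Q (LinearMap.range φ) := by
  refine Module.length_eq_add_of_exact (LinearMap.ker φ).subtype φ.rangeRestrict
    (Submodule.subtype_injective _) φ.surjective_rangeRestrict ?_
  rw [LinearMap.exact_iff, LinearMap.ker_rangeRestrict, Submodule.range_subtype]

section Lengths

variable {Q : Type u} [CommRing Q] [IsLocalRing Q]
  (C : ChainComplex (ModuleCat.{u} Q) ℕ) (hC : ∀ n, Module.Flat Q (C.X n))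
  (M : Type u) [AddCommGroup M] [Module Q M] [Module.Finite Q M]

theorem length_torObj_quotient_smul_top (i : ℕ) :
    Module.length Q (torObj C i (M ⧸ (maximalIdeal Q • ⊤ : Submodule Q M))) =
      hilbertCoeff Q M 0 * Module.length Q (torObj C i (Q ⧸ maximalIdeal Q)) := by
  obtain ⟨e⟩ := nonempty_quotient_smul_top_equiv Q M
  rw [length_torObj_of_equiv_pi C i e, hilbertCoeff_zero]

theorem length_torObj_smul_top [IsNoetherianRing Q]
    (hM : (maximalIdeal Q ^ 2 • ⊤ : Submodule Q M) = ⊥) (i : ℕ) :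
    Module.length Q (torObj C i (maximalIdeal Q • ⊤ : Submodule Q M)) =
      hilbertCoeff Q M 1 * Module.length Q (torObj C i (Q ⧸ maximalIdeal Q)) := by
  obtain ⟨e⟩ := nonempty_equiv_of_smul_top_eq_bot Q _ (maximalIdeal_smul_smul_top_eq_bot Q M hM)
  rw [length_torObj_of_equiv_pi C i e, hilbertCoeff_one]

/-- The map `H_i(𝔪 M ⊗ C) → H_i(M ⊗ C)`. -/
abbrev torSubtype (i : ℕ) :=
  torMap C i (maximalIdeal Q • ⊤ : Submodule Q M).subtype

/-- The map `H_i(M ⊗ C) → H_i(M / 𝔪 M ⊗ C)`. -/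
abbrev torMkQ (i : ℕ) :=
  torMap C i (maximalIdeal Q • ⊤ : Submodule Q M).mkQ

theorem length_ker_add_length_range_torSubtype [IsNoetherianRing Q]
    (hM : (maximalIdeal Q ^ 2 • ⊤ : Submodule Q M) = ⊥) (i : ℕ) :
    hilbertCoeff Q M 1 * Module.length Q (torObj C i (Q ⧸ maximalIdeal Q)) =
      Module.length Q (LinearMap.ker (torSubtype C M i)) +
        Module.length Q (LinearMap.range (torSubtype C M i)) := by
  rw [← length_torObj_smul_top C M hM, ← LinearMap.length_eq_ker_add_range]

omit [Module.Finite Q M] in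
include hC in
theorem length_torObj_eq_add (i : ℕ) :
    Module.length Q (torObj C i M) = Module.length Q (LinearMap.range (torSubtype C M i)) +
      Module.length Q (LinearMap.range (torMkQ C M i)) := by
  have h := exact_torMap_torMap C i hC (Submodule.subtype_injective _)
    (LinearMap.exact_subtype_mkQ (maximalIdeal Q • ⊤ : Submodule Q M)) (Submodule.mkQ_surjective _)
  rw [LinearMap.length_eq_ker_add_range (torMkQ C M i), LinearMap.exact_iff.1 h]

theorem hilbertCoeff_zero_mul_length_zero :
    hilbertCoeff Q M 0 * Module.length Q (torObj C 0 (Q ⧸ maximalIdeal Q)) =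
      Module.length Q (LinearMap.range (torMkQ C M 0)) := by
  rw [← length_torObj_quotient_smul_top,
    LinearMap.range_eq_top.2 (torMap_zero_surjective C (Submodule.mkQ_surjective _)),
    Module.length_top]

include hC in
-- Rank-nullity for the connecting map Tor_{i+1}(M/𝔪M, N) → Tor_i(𝔪M, N), applied to a general flat
-- complex.
theorem hilbertCoeff_zero_mul_length_succ (i : ℕ) :
    hilbertCoeff Q M 0 * Module.length Q (torObj C (i + 1) (Q ⧸ maximalIdeal Q)) =
      Module.length Q (LinearMap.range (torMkQ C M (i + 1))) +
        Module.length Q (LinearMap.ker (torSubtype C M i)) := by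
  have hex := LinearMap.exact_subtype_mkQ (maximalIdeal Q • ⊤ : Submodule Q M)
  have h1 := exact_torMap_torδ C i hC (Submodule.subtype_injective _) hex
    (Submodule.mkQ_surjective _)
  have h2 := exact_torδ_torMap C i hC (Submodule.subtype_injective _) hex
    (Submodule.mkQ_surjective _)
  rw [← length_torObj_quotient_smul_top, LinearMap.length_eq_ker_add_range
    (torδ C i hC (Submodule.subtype_injective _) hex (Submodule.mkQ_surjective _)),
    LinearMap.exact_iff.1 h1, LinearMap.exact_iff.1 h2]

end Lengths

/-- The maps `Q / (f) → M` given by the elements of a module `M` killed by `f`. -/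
def quotientSpanToModule {Q : Type u} [CommRing Q] {f : Q} {M : Type u} [AddCommGroup M]
    [Module Q M] (hfM : ∀ z : M, f • z = 0) : M →ₗ[Q] (Q ⧸ Ideal.span {f}) →ₗ[Q] M where
  toFun z := Submodule.liftQ _ (LinearMap.toSpanSingleton Q M z) (by
    rw [Ideal.span, Submodule.span_le, Set.singleton_subset_iff]
    exact hfM z)
  map_add' z w := Submodule.linearMap_qext _ (LinearMap.ext fun q => smul_add q z w)
  map_smul' a z := Submodule.linearMap_qext _ (LinearMap.ext fun q => smul_comm q a z)

/-! ### Lengths of Tor(k, N) and Tor(M, N) -/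

namespace IsExactPair

section

variable {Q : Type u} [CommRing Q] [IsLocalRing Q] [IsNoetherianRing Q]
  {N : Type u} [AddCommGroup N] [Module Q N]
  (P : ProjectiveResolution (ModuleCat.of Q N)) {f g : Q} (h : IsExactPair f g)
  (hf : ∀ x : N, f • x = 0) (hg : ∀ x : N, g • x = 0)
  (hshort : maximalIdeal Q ^ 3 = ⊥)
  (hprincipal : (maximalIdeal Q).IsPrincipal → maximalIdeal Q ^ 2 = ⊥)

include h hf hg hshort hprincipal

omit [IsNoetherianRing Q] hf hg hprincipal in
theorem exists_residue_map {x : Q} (hx : x ∈ maximalIdeal Q) :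
    ∃ φ : (Q ⧸ maximalIdeal Q) →ₗ[Q] (Q ⧸ Ideal.span {f}),
      φ ∘ₗ (maximalIdeal Q).mkQ = (Ideal.span {f}).mkQ ∘ₗ LinearMap.mulLeft Q x := by
  refine ⟨Submodule.liftQ _ ((Ideal.span {f}).mkQ ∘ₗ LinearMap.mulLeft Q x) fun y hy => ?_,
    LinearMap.ext fun y => rfl⟩
  rw [LinearMap.mem_ker, LinearMap.comp_apply, Submodule.mkQ_apply, Submodule.Quotient.mk_eq_zero]
  apply h.sq_le_span_left hshort
  rw [pow_two]
  exact Ideal.mul_mem_mul hx hy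

/-- One inclusion is the crux, applied to each line of 𝔪R. For the other, multiplication by a ∈ 𝔪 on
R factors through 𝔪R. -/
theorem range_torSubtype_quotient (i : ℕ) :
    LinearMap.range (torSubtype P.complex (Q ⧸ Ideal.span {f}) i) = maximalIdeal Q • ⊤ := by
  apply le_antisymm
  · obtain ⟨e⟩ := nonempty_equiv_of_smul_top_eq_bot Q _ (maximalIdeal_smul_smul_top_eq_bot Q
      (Q ⧸ Ideal.span {f}) (h.sq_smul_top_eq_bot hshort smul_quotient_span_eq_zero))
    refine range_torMap_le_of_equiv_pi P.complex i e _ _ fun φ => ?_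
    have hmem := (φ ((maximalIdeal Q).mkQ 1)).2
    obtain ⟨x, hx, hxφ⟩ := (Ideal.smul_top_quotient (maximalIdeal Q) (Ideal.span {f})).le hmem
    refine range_torMap_le_smul_top P hshort hprincipal i h hf hg x hx _ (LinearMap.ext_ring ?_)
    simpa using hxφ.symm
  · rw [Submodule.smul_le]
    intro a ha t _
    let χ : (Q ⧸ Ideal.span {f}) →ₗ[Q] (maximalIdeal Q • ⊤ : Submodule Q (Q ⧸ Ideal.span {f})) :=
      LinearMap.codRestrict _ (a • LinearMap.id) fun y =>
        Submodule.smul_mem_smul ha Submodule.mem_top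
    refine ⟨torMap P.complex i χ t, ?_⟩
    have e : (maximalIdeal Q • ⊤ : Submodule Q (Q ⧸ Ideal.span {f})).subtype ∘ₗ χ =
      a • LinearMap.id := LinearMap.ext fun y => rfl
    rw [← torMap_comp_apply, e, map_smul, torMap_id]
    rfl

/-- In Tor_i(R, N) ≅ N, the part coming from 𝔪R has the length of 𝔪N, so the part surviving in
Tor_i(k, N) has the length of N/𝔪N. The long exact sequence then relates consecutive lengths. -/
theorem length_torObj_residue [Module.Finite Q N] :
    ∃ τ : ℕ → ℕ, (∀ i, Module.length Q (torObj P.complex i (Q ⧸ maximalIdeal Q)) = τ i) ∧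
      τ 0 = hilbertCoeff Q N 0 ∧
      ∀ i, τ (i + 1) + hilbertCoeff Q N 1 =
        hilbertCoeff Q N 0 + hilbertCoeff Q (Q ⧸ Ideal.span {f}) 1 * τ i := by
  set R := Q ⧸ Ideal.span {f}
  have hR : (maximalIdeal Q ^ 2 • ⊤ : Submodule Q R) = ⊥ :=
    h.sq_smul_top_eq_bot hshort smul_quotient_span_eq_zero
  have hN := length_eq_add_hilbertCoeff_zero Q N
  have hN1 := length_smul_top Q N (h.sq_smul_top_eq_bot hshort hf)
  have hT : ∀ i, Module.length Q (torObj P.complex i R) =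
      hilbertCoeff Q N 1 + hilbertCoeff Q N 0 := fun i => by
    obtain ⟨e⟩ := nonempty_torObj_equiv P i h hf hg
    rw [e.length_eq, hN, hN1]
  have hr : ∀ i, Module.length Q (LinearMap.range (torSubtype P.complex R i)) =
      hilbertCoeff Q N 1 := fun i => by
    obtain ⟨e⟩ := nonempty_torObj_equiv P i h hf hg
    have hmap : (maximalIdeal Q • ⊤ : Submodule Q (torObj P.complex i R)).map
        e.toLinearMap = maximalIdeal Q • ⊤ := by
      rw [Submodule.map_smul'', Submodule.map_top, LinearEquiv.range]
    rw [h.range_torSubtype_quotient P hf hg hshort hprincipal, ← hN1, ← hmap,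
      (Submodule.equivMapOfInjective e.toLinearMap e.injective _).length_eq]
  have hc : ∀ i, Module.length Q (LinearMap.range (torMkQ P.complex R i)) =
      hilbertCoeff Q N 0 := fun i => by
    have := length_torObj_eq_add P.complex (ProjectiveResolution.flat P) R i
    rw [hT, hr] at this
    exact (ENat.add_right_injective_of_ne_top (ENat.natCast_ne_top _) this).symm
  have h0 := hilbertCoeff_zero_mul_length_zero P.complex R
  rw [h.hilbertCoeff_quotient_zero, Nat.cast_one, one_mul, hc] at h0
  have hs : ∀ i, Module.length Q (torObj P.complex (i + 1) (Q ⧸ maximalIdeal Q)) +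
      hilbertCoeff Q N 1 = hilbertCoeff Q N 0 + hilbertCoeff Q R 1 *
        Module.length Q (torObj P.complex i (Q ⧸ maximalIdeal Q)) := fun i => by
    have := hilbertCoeff_zero_mul_length_succ P.complex (ProjectiveResolution.flat P) R i
    rw [h.hilbertCoeff_quotient_zero, Nat.cast_one, one_mul, hc] at this
    rw [length_ker_add_length_range_torSubtype P.complex R hR, this, hr, add_assoc]
  -- Lengths live in `ℕ∞`; the recursion itself propagates finiteness, starting from degree 0.
  have hfin : ∀ i, Module.length Q (torObj P.complex i (Q ⧸ maximalIdeal Q)) ≠ ⊤ := fun i => by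
    induction i with
    | zero => rw [h0]; exact ENat.natCast_ne_top _
    | succ i ih =>
      intro htop
      have := hs i
      rw [htop, top_add, ← ENat.natCast_toNat ih] at this
      norm_cast at this
  refine ⟨fun i => (Module.length Q (torObj P.complex i (Q ⧸ maximalIdeal Q))).toNat,
    fun i => (ENat.natCast_toNat (hfin i)).symm, ?_, fun i => ?_⟩
  · simp only [h0, ENat.toNat_natCast]
  · have := hs i
    rw [← ENat.natCast_toNat (hfin i), ← ENat.natCast_toNat (hfin (i + 1))] at this
    exact_mod_cast this

variable {M : Type u} [AddCommGroup M] [Module Q M] (hfM : ∀ z : M, f • z = 0)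
  (hMN : ∀ a ∈ maximalIdeal Q, ∀ z : M ⊗[Q] N, a • z = 0)

include hfM hMN

omit [IsNoetherianRing Q] hshort hprincipal in
-- The element is the image of z ⊗ t under a linear map from M ⊗ Tor_i(R, N) ≅ M ⊗ N, which 𝔪 kills.
theorem smul_torMap_quotientSpanToModule (i : ℕ) {a : Q} (ha : a ∈ maximalIdeal Q) (z : M)
    (t : torObj P.complex i (Q ⧸ Ideal.span {f})) :
    a • torMap P.complex i (quotientSpanToModule hfM z) t = 0 := by
  obtain ⟨e⟩ := nonempty_torObj_equiv P i h hf hg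
  let B : M ⊗[Q] torObj P.complex i (Q ⧸ Ideal.span {f}) →ₗ[Q] torObj P.complex i M :=
    TensorProduct.lift (torMap P.complex i ∘ₗ quotientSpanToModule hfM)
  have hB : B (z ⊗ₜ t) = torMap P.complex i (quotientSpanToModule hfM z) t := rfl
  have h0 : a • (z ⊗ₜ[Q] t) = 0 := by
    apply (LinearEquiv.lTensor M e).injective
    rw [map_smul, hMN a ha, map_zero]
  rw [← hB, ← map_smul, h0, map_zero]

theorem torSubtype_eq_zero [Module.Finite Q M] (i : ℕ) : torSubtype P.complex M i = 0 := by
  have hM := h.sq_smul_top_eq_bot hshort hfM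
  obtain ⟨e⟩ := nonempty_equiv_of_smul_top_eq_bot Q _ (maximalIdeal_smul_smul_top_eq_bot Q M hM)
  rw [← LinearMap.range_eq_bot, eq_bot_iff]
  refine range_torMap_le_of_equiv_pi P.complex i e _ _ fun φ => ?_
  -- For x = az the map k → M factors as k → R → M: the first map lands in 𝔪 Tor_i(R, N), which the
  -- second kills. Sums follow by additivity in the map.
  have key : ∀ x ∈ (maximalIdeal Q • ⊤ : Submodule Q M),
      ∃ χ : (Q ⧸ maximalIdeal Q) →ₗ[Q] M, χ ((maximalIdeal Q).mkQ 1) = x ∧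
        torMap P.complex i χ = 0 := by
    intro x hx
    induction hx using Submodule.smul_induction_on' with
    | smul a ha z _ =>
      obtain ⟨ρ, hρ⟩ := h.exists_residue_map hshort ha
      refine ⟨quotientSpanToModule hfM z ∘ₗ ρ, ?_, LinearMap.ext fun v => ?_⟩
      · have := LinearMap.congr_fun hρ 1
        simp only [LinearMap.comp_apply, LinearMap.mulLeft_apply, mul_one] at this ⊢
        rw [this]
        exact LinearMap.toSpanSingleton_apply Q M z a
      · rw [torMap_comp_apply]
        have hv := range_torMap_le_smul_top P hshort hprincipal i h hf hg a ha ρ hρ ⟨v, rfl⟩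
        have hle : (maximalIdeal Q • ⊤ :
            Submodule Q (torObj P.complex i (Q ⧸ Ideal.span {f}))) ≤
            LinearMap.ker (torMap P.complex i (quotientSpanToModule hfM z)) := by
          rw [Submodule.smul_le]
          intro b hb t _
          rw [LinearMap.mem_ker, map_smul]
          exact h.smul_torMap_quotientSpanToModule P hf hg hfM hMN i hb z t
        exact hle hv
    | add x _ y _ hx hy =>
      obtain ⟨χ, rfl, h0⟩ := hx
      obtain ⟨χ', rfl, h0'⟩ := hy
      exact ⟨χ + χ', rfl, by rw [map_add, h0, h0', add_zero]⟩
  obtain ⟨χ, hχ, h0⟩ := key _ (φ ((maximalIdeal Q).mkQ 1)).2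
  have heq : (maximalIdeal Q • ⊤ : Submodule Q M).subtype ∘ₗ φ = χ := by
    refine Submodule.linearMap_qext _ (LinearMap.ext_ring ?_)
    exact hχ.symm
  rw [heq, h0, LinearMap.range_zero]

theorem length_torObj_add [Module.Finite Q M] :
    hilbertCoeff Q M 0 * Module.length Q (torObj P.complex 0 (Q ⧸ maximalIdeal Q)) =
      Module.length Q (torObj P.complex 0 M) ∧
    ∀ i, hilbertCoeff Q M 0 * Module.length Q (torObj P.complex (i + 1) (Q ⧸ maximalIdeal Q)) =
      Module.length Q (torObj P.complex (i + 1) M) +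
        hilbertCoeff Q M 1 * Module.length Q (torObj P.complex i (Q ⧸ maximalIdeal Q)) := by
  have hM := h.sq_smul_top_eq_bot hshort hfM
  have hr : ∀ i, Module.length Q (LinearMap.range (torSubtype P.complex M i)) = 0 := fun i => by
    rw [h.torSubtype_eq_zero P hf hg hshort hprincipal hfM hMN, LinearMap.range_zero,
      Module.length_bot]
  have hT : ∀ i, Module.length Q (torObj P.complex i M) =
      Module.length Q (LinearMap.range (torMkQ P.complex M i)) := fun i => by
    rw [length_torObj_eq_add P.complex (ProjectiveResolution.flat P) M i, hr, zero_add]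
  refine ⟨?_, fun i => ?_⟩
  · rw [hT, hilbertCoeff_zero_mul_length_zero]
  · rw [hT, hilbertCoeff_zero_mul_length_succ P.complex (ProjectiveResolution.flat P),
      length_ker_add_length_range_torSubtype P.complex M hM, hr, add_zero]

end

end IsExactPair

/-! ### Generating functions and the final identity -/

section Series

variable {Q : Type u} [CommRing Q] [IsLocalRing Q] [IsNoetherianRing Q]

theorem rescale_hilbertSeries_of_sq_smul_top_eq_bot {M : Type u} [AddCommGroup M] [Module Q M]
    [Module.Finite Q M] (hM : (maximalIdeal Q ^ 2 • ⊤ : Submodule Q M) = ⊥) :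
    rescale (-1 : ℚ) (hilbertSeries Q M) =
      C (hilbertCoeff Q M 0 : ℚ) - X * C (hilbertCoeff Q M 1 : ℚ) := by
  ext n
  rw [coeff_rescale, hilbertSeries, coeff_mk, map_sub]
  match n with
  | 0 => simp
  | 1 => simp [-map_natCast, -map_add, coeff_X]
  | n + 2 =>
    have hz : (maximalIdeal Q ^ (n + 2) • ⊤ : Submodule Q M) = ⊥ := by
      rw [pow_add, Submodule.mul_smul, hM, Submodule.smul_bot]
    rw [hilbertCoeff_eq_zero Q M hz]
    simp [-map_natCast, -map_add, coeff_X]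

theorem IsExactPair.rescale_hilbertSeries_self {f g : Q} (h : IsExactPair f g)
    (hshort : maximalIdeal Q ^ 3 = ⊥)
    (hprincipal : (maximalIdeal Q).IsPrincipal → maximalIdeal Q ^ 2 = ⊥) :
    rescale (-1 : ℚ) (hilbertSeries Q Q) =
      (1 - X) * (1 - X * C (hilbertCoeff Q (Q ⧸ Ideal.span {f}) 1 : ℚ)) := by
  rw [← h.symm.hilbertCoeff_self_two hshort hprincipal]
  have e : (1 - X) * (1 - X * C (hilbertCoeff Q Q 2 : ℚ)) =
      1 - X * C (hilbertCoeff Q Q 2 + 1 : ℚ) + X * (X * C (hilbertCoeff Q Q 2 : ℚ)) := by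
    rw [map_add, map_one]; ring
  rw [e]
  ext n
  rw [coeff_rescale, hilbertSeries, coeff_mk, map_add, map_sub]
  match n with
  | 0 => simp [IsExactPair.hilbertCoeff_self_zero]
  | 1 =>
    simp [-map_natCast, -map_add, h.hilbertCoeff_self_one hshort hprincipal, coeff_succ_X_mul, coeff_one, coeff_X]
  | 2 => simp [-map_natCast, -map_add, coeff_succ_X_mul, coeff_one, coeff_X]
  | n + 3 =>
    have hz : (maximalIdeal Q ^ (n + 3) • ⊤ : Submodule Q Q) = ⊥ := by
      rw [pow_add, Submodule.mul_smul, hshort, Submodule.bot_smul, Submodule.smul_bot]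
    rw [hilbertCoeff_eq_zero Q Q hz]
    simp [-map_natCast, -map_add, coeff_succ_X_mul, coeff_one, coeff_X]

end Series

/-- The factor 1 - eX leaves c in degree 0 and the constant c - d in every later degree; the factor
1 - X then telescopes. -/
theorem PowerSeries.mk_mul_one_sub_X_mul_one_sub {τ : ℕ → ℕ} {c d e : ℕ} (h0 : τ 0 = c)
    (hs : ∀ i, τ (i + 1) + d = c + e * τ i) :
    (mk fun i => (τ i : ℚ)) * ((1 - X) * (1 - X * C (e : ℚ))) =
      C (c : ℚ) - X * C (d : ℚ) := by
  have hs' : ∀ i, (τ (i + 1) : ℚ) + d = c + e * τ i := fun i => by exact_mod_cast hs i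
  have expand : (mk fun i => (τ i : ℚ)) * ((1 - X) * (1 - X * C (e : ℚ))) =
      (mk fun i => (τ i : ℚ)) - X * (C (1 + e : ℚ) * mk fun i => (τ i : ℚ)) +
        X * (X * (C (e : ℚ) * mk fun i => (τ i : ℚ))) := by
    rw [map_add, map_one]; ring
  rw [expand]
  ext n
  rw [map_add, map_sub]
  match n with
  | 0 => simp [h0]
  | 1 =>
    have := hs' 0
    simp [-map_natCast, -map_add, coeff_succ_X_mul, h0] at this ⊢
    linarith
  | n + 2 =>
    have h1 := hs' n
    have h2 : (τ (n + 2) : ℚ) + d = c + e * τ (n + 1) := hs' (n + 1)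
    simp [-map_natCast, -map_add, coeff_succ_X_mul, coeff_X]
    linarith

theorem PowerSeries.mk_eq_sub_mul_mk {τ t : ℕ → ℕ} {a b : ℕ} (h0 : a * τ 0 = t 0)
    (hs : ∀ i, a * τ (i + 1) = t (i + 1) + b * τ i) :
    (mk fun i => (t i : ℚ)) = (C (a : ℚ) - X * C (b : ℚ)) * mk fun i => (τ i : ℚ) := by
  rw [sub_mul, mul_assoc]
  ext n
  rw [map_sub]
  match n with
  | 0 => simp [← h0]
  | n + 1 =>
    have : (a * τ (n + 1) : ℚ) = t (n + 1) + b * τ n := by exact_mod_cast hs n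
    simp [-map_natCast, -map_add, coeff_succ_X_mul]
    linarith

/-- Scalars of Q/I lift to Q, so the identity on pure tensors defines an additive map from the
tensor product over Q/I to the one over Q, which transports the vanishing. -/
theorem smul_tensor_eq_zero_of_quotient {Q : Type u} [CommRing Q] {I J : Ideal Q} {M N : Type u}
    [AddCommGroup M] [AddCommGroup N] [Module (Q ⧸ I) M] [Module (Q ⧸ I) N]
    [Module Q M] [IsScalarTower Q (Q ⧸ I) M] [Module Q N] [IsScalarTower Q (Q ⧸ I) N]
    (hMN : ∀ a ∈ J, ∀ z : M ⊗[Q ⧸ I] N, a • z = 0) :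
    ∀ a ∈ J, ∀ z : M ⊗[Q] N, a • z = 0 := by
  let F : M ⊗[Q ⧸ I] N →+ M ⊗[Q] N := TensorProduct.liftAddHom
    ((LinearMap.toAddMonoidHom'.comp (TensorProduct.mk Q M N).toAddMonoidHom)) (fun r m n => by
      obtain ⟨q, rfl⟩ := Ideal.Quotient.mk_surjective r
      have hm : (Ideal.Quotient.mk I q) • m = q • m := algebraMap_smul (Q ⧸ I) q m
      have hn : (Ideal.Quotient.mk I q) • n = q • n := algebraMap_smul (Q ⧸ I) q n
      rw [hm, hn]
      exact TensorProduct.smul_tmul q m n)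
  intro a ha z
  induction z with
  | zero => exact smul_zero a
  | add x y hx hy => rw [smul_add, hx, hy, add_zero]
  | tmul m n =>
    have h1 : F ((a • m) ⊗ₜ n) = (a • m) ⊗ₜ n := rfl
    rw [TensorProduct.smul_tmul', ← h1, ← TensorProduct.smul_tmul', hMN a ha, map_zero]

end

theorem mainTheorem5 {Q : Type u} [CommRing Q] [IsLocalRing Q] [IsNoetherianRing Q]
    [CharZero (ResidueField Q)]
    (hshort : maximalIdeal Q ^ 3 = ⊥)
    (hprincipal : (maximalIdeal Q).IsPrincipal → maximalIdeal Q ^ 2 = ⊥)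
    {f g : Q} (hfg : IsExactPair f g)
    (M N : Type u) [AddCommGroup M] [AddCommGroup N]
    [Module (Q ⧸ Ideal.span {f}) M] [Module (Q ⧸ Ideal.span {f}) N]
    [Module.Finite (Q ⧸ Ideal.span {f}) M] [Module.Finite (Q ⧸ Ideal.span {f}) N]
    [Module Q M] [IsScalarTower Q (Q ⧸ Ideal.span {f}) M]
    [Module Q N] [IsScalarTower Q (Q ⧸ Ideal.span {f}) N]
    (hMN : ∀ a ∈ maximalIdeal Q, ∀ z : M ⊗[Q ⧸ Ideal.span {f}] N, a • z = 0)
    (hgN : ∀ x : N, g • x = 0) :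
    (∀ i : ℕ, Module.length Q (torModule Q M N i) ≠ ⊤) ∧
      poincareSeries Q M N =
        rescale (-1 : ℚ) (hilbertSeries Q M) * rescale (-1 : ℚ) (hilbertSeries Q N) *
          (rescale (-1 : ℚ) (hilbertSeries Q Q))⁻¹ := by
  have : Module.Finite Q M := Module.Finite.trans (Q ⧸ Ideal.span {f}) M
  have : Module.Finite Q N := Module.Finite.trans (Q ⧸ Ideal.span {f}) N
  have hf0 : algebraMap Q (Q ⧸ Ideal.span {f}) f = 0 :=
    Ideal.Quotient.eq_zero_iff_mem.2 (Ideal.mem_span_singleton_self f)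
  have hfM : ∀ z : M, f • z = 0 := fun z => by
    rw [← algebraMap_smul (Q ⧸ Ideal.span {f}) f z, hf0, zero_smul]
  have hfN : ∀ x : N, f • x = 0 := fun x => by
    rw [← algebraMap_smul (Q ⧸ Ideal.span {f}) f x, hf0, zero_smul]
  let P := projectiveResolution (ModuleCat.of Q N)
  obtain ⟨τ, hτ, hτ0, hτs⟩ := hfg.length_torObj_residue P hfN hgN hshort hprincipal
  obtain ⟨h0, hs⟩ := hfg.length_torObj_add P hfN hgN hshort hprincipal hfM
    (smul_tensor_eq_zero_of_quotient hMN)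
  simp only [hτ, ← (torModuleEquiv _ P).length_eq] at h0 hs
  have hfin : ∀ i, Module.length Q (torModule Q M N i) ≠ ⊤ := fun i => by
    cases i with
    | zero => rw [← h0, ← Nat.cast_mul]; exact ENat.natCast_ne_top _
    | succ i =>
      have h1 := le_self_add.trans_eq (hs i).symm
      rw [← Nat.cast_mul] at h1
      exact ne_top_of_le_ne_top (ENat.natCast_ne_top _) h1
  refine ⟨hfin, ?_⟩
  have h0' : hilbertCoeff Q M 0 * τ 0 = (Module.length Q (torModule Q M N 0)).toNat := by
    rw [← ENat.natCast_toNat (hfin 0)] at h0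
    exact_mod_cast h0
  have hs' : ∀ i, hilbertCoeff Q M 0 * τ (i + 1) =
      (Module.length Q (torModule Q M N (i + 1))).toNat + hilbertCoeff Q M 1 * τ i := fun i => by
    have := hs i
    rw [← ENat.natCast_toNat (hfin (i + 1))] at this
    exact_mod_cast this
  rw [PowerSeries.eq_mul_inv_iff_mul_eq, poincareSeries,
    PowerSeries.mk_eq_sub_mul_mk (t := fun i => (Module.length Q (torModule Q M N i)).toNat) h0' hs',
    hfg.rescale_hilbertSeries_self hshort hprincipal, mul_assoc,
    PowerSeries.mk_mul_one_sub_X_mul_one_sub hτ0 hτs,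
    rescale_hilbertSeries_of_sq_smul_top_eq_bot (hfg.sq_smul_top_eq_bot hshort hfM),
    rescale_hilbertSeries_of_sq_smul_top_eq_bot (hfg.sq_smul_top_eq_bot hshort hfN)]
  -- What remains is the invertibility of H_Q(-t): its constant coefficient is 1.
  rw [hfg.rescale_hilbertSeries_self hshort hprincipal]
  simp
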